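/- Let $K_3\times P_n$ be the Cartesian product of the triangle with the path on $n$ vertices, and let $k\ge 1$ be an integer. A $k$-colored partition of a graph $G$ is a partition of its vertex set into $s\ge 1$ nonempty blocks, each inducing a connected subgraph, together with an assignment of one of $k$ colors to each block such that any two distinct blocks joined by an edge have different colors; its size $\rho$ is the number of blocks. Let $\mathcal T^{(k)}(G)$ be the set of $k$-colored partitions of $G$ and let $$T(x,y)=\sum_{n\ge 0}x^n\sum_{\tau\in\mathcal T^{(k)}(K_3\times P_n)}y^{\rho(\tau)}$$ as a formal power series in $x$ over $\mathbb Z[y]$ (the term $n=0$ is $0$, because $s\ge 1$). (1) $T(x,y)=p(x,y)/q(x,y)$, where $q$ is invertible as a power series in $x$ and $$\begin{aligned}p(x,y)=kxy\Big(&1-(1-k)y(3-(2-k)y)\\&-x(1-y)\big(4-y(13-5k)+(3+k)(3-2k)y^2-(1-k)(1+(3-k)k)y^3\big)\\&+x^2(1-y)^2\big(3-(2+4k)y+(1-k+3k^2)y^2+k^2(1-k)y^3\big)\Big),\end{aligned}$$ $$\begin{aligned}q(x,y)=1-x\Big(&5-12(2-k)y+x^2(1-y)^2\big(3-(2+4k)y+k(1+2k)y^2+k(1-k)y^3-(k-1)^4y^4\big)\\&-x(1-y)\big(7-(25-8k)y+(20-3k-4k^2)y^2+(5-24k+21k^2-5k^3)y^3\\&\qquad-(7-18k+17k^2-7k^3+k^4)y^4\big)\\&+y^2\big(32-26k+6k^2-(13-14k+6k^2-k^3)y\big)\Big).\end{aligned}$$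 (2) For $i=1,2,3$ let $T_i(x,y)$ be the part of $T(x,y)$ contributed, for $n\ge1$, by those $k$-colored partitions of $K_3\times P_n$ whose last triangle has exactly $i$ different colors. Then $T=T_1+T_2+T_3$ and $$\begin{aligned} T_1={}&kxy+\big(x+(k-1)xy\big)T_1+\big(2x+(k-2)xy\big)T_2+\big(3x+(k-3)xy\big)T_3,\\ T_2={}&3k(k-1)xy^2+\big(6(k-1)xy+3(k-1)(k-2)xy^2\big)T_1\\ &+\big(3x+2xy+xy^2+8(k-2)xy+4(k-2)xy^2+3(k-2)(k-3)xy^2\big)T_2\\ &+\big(6x+6xy+6xy^2+9(k-3)xy+9(k-3)xy^2+3(k-3)(k-4)xy^2\big)T_3,\\ T_3={}&k(k-1)(k-2)xy^3+\big(3(k-1)(k-2)xy^2+(k-1)(k-2)(k-3)xy^3\big)T_1\\ &+\big(2(k-2)(xy+xy^2+xy^3)+3(k-2)(k-3)(xy^2+xy^3)+(k-2)(k-3)(k-4)xy^3\big)T_2\\ &+\big(x+3xy^2+2xy^3+3(k-3)xy+6(k-3)xy^2+9(k-3)xy^3\\ &\qquad+3(k-3)(k-4)xy^2+6(k-3)(k-4)xy^3+(k-3)(k-4)(k-5)xy^3\big)T_3.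 \end{aligned}$$ (3) $[x^n]T(x,1)=k^{3n}$ for all $n\ge 1$. -/

import Mathlib

open Polynomial

namespace ColoredPartitions

/-- A `k`-colored partition of the vertices of `G`: a partition into `s ≥ 1` blocks (nonempty,
pairwise disjoint sets), each inducing a connected subgraph, and an assignment of one of `k`
colors to each block such that neighboring blocks get different colors. -/
@[ext]
structure ColoredPartition {V : Type*} [Fintype V] [DecidableEq V] (G : SimpleGraph V) (k : ℕ) where
  partition : Finpartition (Finset.univ : Finset V)
  nonempty : partition.parts.Nonempty
  connected : ∀ B ∈ partition.parts, (G.induce (B : Set V)).Connected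
  color : {B : Finset V // B ∈ partition.parts} → Fin k
  color_ne : ∀ B C : {B : Finset V // B ∈ partition.parts}, B ≠ C →
    (∃ v ∈ B.1, ∃ w ∈ C.1, G.Adj v w) → color B ≠ color C

namespace ColoredPartition

variable {V : Type*} [Fintype V] [DecidableEq V] {G : SimpleGraph V} {k : ℕ}

/-- There are only finitely many `k`-colored partitions. -/
instance instFinite : Finite (ColoredPartition G k) := by
  let f : ColoredPartition G k →
      (Σ P : Finpartition (Finset.univ : Finset V),
        ({B : Finset V // B ∈ P.parts} → Fin k)) := fun T => ⟨T.partition, T.color⟩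
  refine Finite.of_injective f ?_
  rintro ⟨P, h1, h2, c, h3⟩ ⟨P', h1', h2', c', h3'⟩ h
  obtain ⟨hP, hc⟩ := Sigma.mk.inj h
  dsimp only at hP hc
  subst hP
  cases hc
  rfl

noncomputable instance instFintype : Fintype (ColoredPartition G k) := Fintype.ofFinite _

/-- The size of a `k`-colored partition: its number of blocks. -/
def size (T : ColoredPartition G k) : ℕ := T.partition.parts.card

end ColoredPartition

/-- `U n = K₃ × Pₙ` (Cartesian product of graphs). -/
abbrev U (n : ℕ) : SimpleGraph (Fin 3 × Fin n) :=
  SimpleGraph.boxProd (SimpleGraph.completeGraph (Fin 3)) (SimpleGraph.pathGraph n)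

/-- The number of colors occurring in the last triangle, i.e. on the vertices `(v, n - 1)`. -/
noncomputable def lastColors {n k : ℕ} (T : ColoredPartition (U n) k) : ℕ :=
  {c : Fin k | ∃ B : {B : Finset (Fin 3 × Fin n) // B ∈ T.partition.parts},
    (∃ v ∈ B.1, (v.2 : ℕ) + 1 = n) ∧ T.color B = c}.ncard

/-- The bivariate generating function `T(x,y) = ∑ xⁿ ∑ y ^ size`, as a power series in `x`
with coefficients in `ℤ[y]`. -/
noncomputable def genFun (k : ℕ) : PowerSeries ℤ[X] :=
  PowerSeries.mk fun n => ∑ T : ColoredPartition (U n) k, (X : ℤ[X]) ^ T.size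

open Classical in
/-- The part `T_i(x,y)` of the generating function coming from the `k`-colored partitions of
`U n`, `n ≥ 1`, whose last triangle has exactly `i` different colors. -/
noncomputable def genFunLast (k i : ℕ) : PowerSeries ℤ[X] :=
  PowerSeries.mk fun n =>
    if 1 ≤ n then
      ∑ T : ColoredPartition (U n) k with lastColors T = i, (X : ℤ[X]) ^ T.size
    else 0

/-- The numerator `p(x,y)`, as a polynomial expression in `k, x, y`. -/
def numer {R : Type*} [CommRing R] (k x y : R) : R :=
  k * x * y * (1 - (1 - k) * y * (3 - (2 - k) * y)
    - x * (1 - y) * (4 - y * (13 - 5 * k) + (3 + k) * (3 - 2 * k) * y ^ 2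
      - (1 - k) * (1 + (3 - k) * k) * y ^ 3)
    + x ^ 2 * (1 - y) ^ 2 * (3 - (2 + 4 * k) * y + (1 - k + 3 * k ^ 2) * y ^ 2
      + k ^ 2 * (1 - k) * y ^ 3))

/-- The denominator `q(x,y)`, as a polynomial expression in `k, x, y`. -/
def denom {R : Type*} [CommRing R] (k x y : R) : R :=
  1 - x * (5 - 12 * (2 - k) * y
    + x ^ 2 * (1 - y) ^ 2 * (3 - (2 + 4 * k) * y + k * (1 + 2 * k) * y ^ 2
      + k * (1 - k) * y ^ 3 - (k - 1) ^ 4 * y ^ 4)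
    - x * (1 - y) * (7 - (25 - 8 * k) * y + (20 - 3 * k - 4 * k ^ 2) * y ^ 2
      + (5 - 24 * k + 21 * k ^ 2 - 5 * k ^ 3) * y ^ 3
      - (7 - 18 * k + 17 * k ^ 2 - 7 * k ^ 3 + k ^ 4) * y ^ 4)
    + y ^ 2 * (32 - 26 * k + 6 * k ^ 2 - (13 - 14 * k + 6 * k ^ 2 - k ^ 3) * y))

/-- The transfer system: three linear equations over a commutative ring relating the
generating functions `T₁, T₂, T₃` according to the number of colors in the last triangle. -/
def TransferSystem {R : Type*} [CommRing R] (k x y T₁ T₂ T₃ : R) : Prop :=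
  (T₁ = k * x * y
    + (x + (k - 1) * x * y) * T₁
    + (2 * x + (k - 2) * x * y) * T₂
    + (3 * x + (k - 3) * x * y) * T₃) ∧
  (T₂ = 3 * k * (k - 1) * x * y ^ 2
    + (6 * (k - 1) * x * y + 3 * (k - 1) * (k - 2) * x * y ^ 2) * T₁
    + (3 * x + 2 * x * y + x * y ^ 2 + 8 * (k - 2) * x * y + 4 * (k - 2) * x * y ^ 2
      + 3 * (k - 2) * (k - 3) * x * y ^ 2) * T₂
    + (6 * x + 6 * x * y + 6 * x * y ^ 2 + 9 * (k - 3) * x * y + 9 * (k - 3) * x * y ^ 2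
      + 3 * (k - 3) * (k - 4) * x * y ^ 2) * T₃) ∧
  (T₃ = k * (k - 1) * (k - 2) * x * y ^ 3
    + (3 * (k - 1) * (k - 2) * x * y ^ 2 + (k - 1) * (k - 2) * (k - 3) * x * y ^ 3) * T₁
    + (2 * (k - 2) * x * y + 2 * (k - 2) * x * y ^ 2 + 2 * (k - 2) * x * y ^ 3
      + 3 * (k - 2) * (k - 3) * x * y ^ 2 + 3 * (k - 2) * (k - 3) * x * y ^ 3
      + (k - 2) * (k - 3) * (k - 4) * x * y ^ 3) * T₂
    + (x + 3 * x * y ^ 2 + 2 * x * y ^ 3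
      + 3 * (k - 3) * x * y + 6 * (k - 3) * x * y ^ 2 + 9 * (k - 3) * x * y ^ 3
      + 3 * (k - 3) * (k - 4) * x * y ^ 2 + 6 * (k - 3) * (k - 4) * x * y ^ 3
      + (k - 3) * (k - 4) * (k - 5) * x * y ^ 3) * T₃)

/-- The variable `y`, viewed as a constant power series in `x`. -/
noncomputable abbrev yVar : PowerSeries ℤ[X] := PowerSeries.C (X : ℤ[X])

/-- The variable `x`. -/
noncomputable abbrev xVar : PowerSeries ℤ[X] := PowerSeries.X

end ColoredPartitions

open ColoredPartitions

/-! A colored partition is the same thing as an arbitrary vertex coloring: its blocks must be the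
monochromatic connected components (`equivVertexColor`), and its size is their number
(`size_eq_monoCount`). Setting y = 1 therefore counts all colorings of 3n vertices.

Since each layer is a complete graph, equally colored vertices of one layer lie in one component.
Adding a triangle thus never merges old components: each of its colors either joins exactly one old
component, through a vertical edge with equally colored ends, or starts a new component. So the size
grows by `newColors`, which depends on the last two triangles only (`monoCount_succ`).

The sum of y ^ `newColors` over next triangles with i colors depends on the current triangle only
through its number of colors (`sum_pow_newColors`, by inclusion-exclusion). This yields a 3 × 3
transfer matrix A and a linear system for the three generating functions. Up to ring identities, q
is det(1 - xA), and p is the numerator that Cramer's rule gives for the sum of the unknowns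
(`cramer_three_sum`). -/

namespace ColoredPartitions

/-! ### Monochromatic components of a vertex coloring -/

/-- The spanning subgraph of `G` consisting of the edges with equally colored ends. -/
def monoGraph {V K : Type*} (G : SimpleGraph V) (c : V → K) : SimpleGraph V where
  Adj v w := G.Adj v w ∧ c v = c w
  symm := ⟨fun _ _ h => ⟨h.1.symm, h.2.symm⟩⟩
  loopless := ⟨fun _ h => G.loopless.irrefl _ h.1⟩

/-- The number of monochromatic components of a coloring. -/
noncomputable def monoCount {V K : Type*} (G : SimpleGraph V) (c : V → K) : ℕ :=
  Nat.card (monoGraph G c).ConnectedComponent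

/-- A complete invariant of the components counts them. It is applied with three invariants: the
block of a vertex, the color in a single triangle, and the map `F` of `monoCount_succ`. -/
theorem card_connectedComponent_eq_ncard_range {V Y : Type*} {H : SimpleGraph V} (F : V → Y)
    (h : ∀ v w, H.Reachable v w ↔ F v = F w) :
    Nat.card H.ConnectedComponent = (Set.range F).ncard := by
  rw [← Nat.card_coe_set_eq]
  refine Nat.card_congr (Equiv.ofBijective (fun C => Quot.liftOn C
    (fun v => (⟨F v, v, rfl⟩ : Set.range F)) fun v w hvw => Subtype.ext ((h v w).1 hvw)) ⟨?_, ?_⟩)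
  · rintro ⟨v⟩ ⟨w⟩ hvw
    exact Quot.sound ((h v w).2 (Subtype.ext_iff.1 hvw))
  · rintro ⟨_, v, rfl⟩
    exact ⟨Quot.mk _ v, rfl⟩

theorem monoGraph_reachable_color {V K : Type*} {G : SimpleGraph V} {c : V → K} {v w : V}
    (h : (monoGraph G c).Reachable v w) : c v = c w := by
  obtain ⟨p⟩ := h
  induction p with
  | nil => rfl
  | cons h _ ih => exact h.2.trans ih

/-! ### Colored partitions as vertex colorings -/

namespace ColoredPartition

variable {V : Type*} [Fintype V] [DecidableEq V] {G : SimpleGraph V} {k : ℕ}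

/-- The block containing a vertex. -/
def block (T : ColoredPartition G k) (v : V) : {B : Finset V // B ∈ T.partition.parts} :=
  ⟨T.partition.part v, T.partition.part_mem.2 (Finset.mem_univ v)⟩

/-- The vertex coloring induced by a colored partition. -/
def vertexColor (T : ColoredPartition G k) (v : V) : Fin k := T.color (T.block v)

theorem mem_block (T : ColoredPartition G k) (v : V) : v ∈ (T.block v).1 :=
  T.partition.mem_part_self.2 (Finset.mem_univ v)

theorem block_eq_of_mem (T : ColoredPartition G k) {v : V}
    {B : {B : Finset V // B ∈ T.partition.parts}} (h : v ∈ B.1) : T.block v = B :=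
  Subtype.ext (T.partition.part_eq_of_mem B.2 h)

theorem block_surjective (T : ColoredPartition G k) : Function.Surjective T.block := fun B => by
  obtain ⟨v, hv⟩ := T.partition.nonempty_of_mem_parts B.2
  exact ⟨v, T.block_eq_of_mem hv⟩

/-- A monochromatic edge cannot leave a block, because distinct neighboring blocks differ in color;
conversely each block is connected and has a single color. -/
theorem reachable_iff_block_eq (T : ColoredPartition G k) (v w : V) :
    (monoGraph G T.vertexColor).Reachable v w ↔ T.block v = T.block w := by
  constructor
  · rintro ⟨p⟩
    induction p with
    | nil => rfl
    | cons h _ ih =>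
      refine Eq.trans ?_ ih
      by_contra hne
      exact T.color_ne _ _ hne ⟨_, T.mem_block _, _, T.mem_block _, h.1⟩ h.2
  · intro h
    have hc := T.connected _ (T.block v).2
    have hr := hc.preconnected ⟨v, T.mem_block v⟩ ⟨w, h ▸ T.mem_block w⟩
    let f : G.induce ((T.block v).1 : Set V) →g monoGraph G T.vertexColor :=
      { toFun := Subtype.val
        map_rel' := fun {a b} hab => ⟨hab, by
          rw [vertexColor, vertexColor, T.block_eq_of_mem a.2, T.block_eq_of_mem b.2]⟩ }
    exact hr.map f

theorem size_eq_monoCount (T : ColoredPartition G k) : T.size = monoCount G T.vertexColor := by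
  rw [monoCount, card_connectedComponent_eq_ncard_range T.block T.reachable_iff_block_eq,
    T.block_surjective.range_eq, Set.ncard_univ, Nat.card_eq_fintype_card, Fintype.card_coe, size]

/-- By `reachable_iff_block_eq` the vertex coloring determines the blocks as its monochromatic
components, and then their colors. -/
theorem vertexColor_injective :
    Function.Injective (vertexColor : ColoredPartition G k → V → Fin k) := by
  intro S T h
  have hb : ∀ v w, S.block v = S.block w ↔ T.block v = T.block w := fun v w => by
    rw [← reachable_iff_block_eq, ← reachable_iff_block_eq, h]
  have hbv : ∀ v, (S.block v).1 = (T.block v).1 := fun v => by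
    ext w
    have hS : w ∈ (S.block v).1 ↔ S.block w = S.block v :=
      ⟨fun h => S.block_eq_of_mem h, fun h => h ▸ S.mem_block w⟩
    have hT : w ∈ (T.block v).1 ↔ T.block w = T.block v :=
      ⟨fun h => T.block_eq_of_mem h, fun h => h ▸ T.mem_block w⟩
    rw [hS, hT, hb]
  have hP : S.partition = T.partition := by
    ext B
    constructor
    · intro hB
      obtain ⟨v, hv⟩ := S.block_surjective ⟨B, hB⟩
      have : B = (T.block v).1 := by rw [← hbv, hv]
      exact this ▸ (T.block v).2
    · intro hB
      obtain ⟨v, hv⟩ := T.block_surjective ⟨B, hB⟩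
      have : B = (S.block v).1 := by rw [hbv, hv]
      exact this ▸ (S.block v).2
  have hcol : ∀ B hS hT, S.color ⟨B, hS⟩ = T.color ⟨B, hT⟩ := fun B hS hT => by
    obtain ⟨v, hv⟩ := S.block_surjective ⟨B, hS⟩
    have hv' : T.block v = ⟨B, hT⟩ := Subtype.ext (by rw [← hbv, hv])
    rw [← hv, ← hv']
    exact congrFun h v
  obtain ⟨P, h1, h2, c, h3⟩ := S
  obtain ⟨P', h1', h2', c', h3'⟩ := T
  dsimp only at hP
  subst hP
  have : c = c' := funext fun B => hcol B.1 B.2 B.2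
  subst this
  rfl

/-- Take the monochromatic components as blocks. A vertex must exist because a colored partition has
at least one block. -/
theorem vertexColor_surjective [Nonempty V] :
    Function.Surjective (vertexColor : ColoredPartition G k → V → Fin k) := by
  classical
  intro c
  let P := Finpartition.ofSetoid (monoGraph G c).reachableSetoid
  have hP : ∀ {B : Finset V}, B ∈ P.parts → ∀ {v}, v ∈ B →
      ∀ {w}, w ∈ B ↔ (monoGraph G c).Reachable v w := fun {B} hB {v} hv {w} => by
    rw [← P.part_eq_of_mem hB hv]
    exact Finpartition.mem_part_ofSetoid_iff_rel
  have hne : ∀ B : {B : Finset V // B ∈ P.parts}, ∃ v, v ∈ B.1 :=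
    fun B => P.nonempty_of_mem_parts B.2
  choose r hr using hne
  have hcol : ∀ (B : {B : Finset V // B ∈ P.parts}) v, v ∈ B.1 → c (r B) = c v := fun B v hv =>
    monoGraph_reachable_color ((hP B.2 (hr B)).1 hv)
  refine ⟨⟨P, ?_, ?_, fun B => c (r B), ?_⟩, ?_⟩
  · obtain ⟨v⟩ := ‹Nonempty V›
    exact ⟨_, P.part_mem.2 (Finset.mem_univ v)⟩
  · intro B hB
    have : Nonempty (B : Set V) := ⟨⟨r ⟨B, hB⟩, hr ⟨B, hB⟩⟩⟩
    refine ⟨?_⟩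
    rintro ⟨v, hv⟩ ⟨w, hw⟩
    -- A monochromatic walk never leaves its component, so it is a walk in the graph induced on `B`.
    obtain ⟨p⟩ := (hP hB hv).1 hw
    induction p with
    | nil => rfl
    | @cons u u' w h p ih =>
      have hu' : u' ∈ B := (hP hB hv).2 (SimpleGraph.Adj.reachable h)
      have hadj : (G.induce (B : Set V)).Adj ⟨u, hv⟩ ⟨u', hu'⟩ := h.1
      exact hadj.reachable.trans (ih hu' hw)
  · rintro B C hne ⟨v, hv, w, hw, hvw⟩ heq
    apply hne
    have hadj : (monoGraph G c).Adj v w :=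
      ⟨hvw, by rw [← hcol B v hv, ← hcol C w hw]; exact heq⟩
    have hwB : w ∈ B.1 := (hP B.2 hv).2 hadj.reachable
    exact Subtype.ext ((P.part_eq_of_mem B.2 hwB).symm.trans (P.part_eq_of_mem C.2 hw))
  · funext v
    exact hcol _ v (P.mem_part_self.2 (Finset.mem_univ v))

/-- Colored partitions correspond to arbitrary vertex colorings. -/
noncomputable def equivVertexColor [Nonempty V] : ColoredPartition G k ≃ (V → Fin k) :=
  Equiv.ofBijective vertexColor ⟨vertexColor_injective, vertexColor_surjective⟩

end ColoredPartition

theorem lastColors_eq {n k : ℕ} (T : ColoredPartition (U (n + 1)) k) :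
    lastColors T = (Set.range fun i => T.vertexColor (i, Fin.last n)).ncard := by
  rw [lastColors]
  congr 1
  ext a
  constructor
  · rintro ⟨B, ⟨⟨i, j⟩, hv, hj⟩, rfl⟩
    have : j = Fin.last n := Fin.ext (by simpa using hj)
    subst this
    exact ⟨i, congrArg T.color (T.block_eq_of_mem hv)⟩
  · rintro ⟨i, rfl⟩
    exact ⟨T.block (i, Fin.last n), ⟨_, T.mem_block _, by simp⟩, rfl⟩

/-! ### Adding one triangle -/

/-- The vertex coloring of `K₃ × Pₙ` given by a sequence of triangle colorings. -/
def stackColor {K : Type*} {n : ℕ} (h : Fin n → Fin 3 → K) : Fin 3 × Fin n → K :=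
  fun p => h p.2 p.1

/-- The number of colors of `c'` that do not continue the color of the same vertex under `c`. -/
def newColors {K : Type*} [DecidableEq K] (c c' : Fin 3 → K) : ℕ :=
  ((Finset.univ.image c').filter fun a => ∀ v, c' v = a → c v ≠ a).card

theorem reachable_of_same_layer {K : Type*} {n : ℕ} (h : Fin n → Fin 3 → K) (j : Fin n)
    {v w : Fin 3} (hc : h j v = h j w) :
    (monoGraph (U n) (stackColor h)).Reachable (v, j) (w, j) := by
  by_cases hvw : v = w
  · rw [hvw]
  · exact SimpleGraph.Adj.reachable ⟨SimpleGraph.boxProd_adj.2 (Or.inl ⟨hvw, rfl⟩), hc⟩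

/-- Old components stay distinct, because the new vertices attached to one old component all have
its color, and a color of the new triangle meets at most one old component. Only the colors without
a vertical monochromatic edge create components. -/
theorem monoCount_succ {K : Type*} [DecidableEq K] {n : ℕ} (h : Fin (n + 2) → Fin 3 → K) :
    monoCount (U (n + 2)) (stackColor h) =
      monoCount (U (n + 1)) (stackColor fun j => h j.castSucc) +
        newColors (h (Fin.last n).castSucc) (h (Fin.last (n + 1))) := by
  classical
  set g : Fin (n + 1) → Fin 3 → K := fun j => h j.castSucc with hg
  set c := h (Fin.last n).castSucc with hc
  set c' := h (Fin.last (n + 1)) with hc'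
  set H := monoGraph (U (n + 1)) (stackColor g) with hH
  set H' := monoGraph (U (n + 2)) (stackColor h) with hH'
  -- The component of color `a` in the new triangle: the old component it continues, or a fresh one
  -- labeled `a`. The choice of `u` is immaterial, since all candidates have color `a` in the same
  -- old triangle.
  let top : K → H.ConnectedComponent ⊕ K := fun a =>
    if hu : ∃ u, c' u = a ∧ c u = a then
      Sum.inl (H.connectedComponentMk (hu.choose, Fin.last n)) else Sum.inr a
  have top_spec : ∀ a, (∃ u, c' u = a ∧ c u = a ∧
      top a = Sum.inl (H.connectedComponentMk (u, Fin.last n))) ∨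
      ((∀ u, c' u = a → c u ≠ a) ∧ top a = Sum.inr a) := fun a => by
    by_cases hu : ∃ u, c' u = a ∧ c u = a
    · exact Or.inl ⟨hu.choose, hu.choose_spec.1, hu.choose_spec.2, dif_pos hu⟩
    · exact Or.inr ⟨fun u h1 h2 => hu ⟨u, h1, h2⟩, dif_neg hu⟩
  -- The complete invariant for the components of `H'`; its range is counted at the end.
  let F : Fin 3 × Fin (n + 2) → H.ConnectedComponent ⊕ K := fun p =>
    Fin.lastCases (motive := fun _ => H.ConnectedComponent ⊕ K) (top (c' p.1))
      (fun j => Sum.inl (H.connectedComponentMk (p.1, j))) p.2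
  have F_last : ∀ v, F (v, Fin.last (n + 1)) = top (c' v) := fun v => by simp [F]
  have F_castSucc : ∀ v j, F (v, Fin.castSucc j) =
      Sum.inl (H.connectedComponentMk (v, j)) := fun v j => by simp [F]
  have cross : ∀ v j w, H'.Adj (v, Fin.castSucc j) (w, Fin.last (n + 1)) →
      F (v, Fin.castSucc j) = F (w, Fin.last (n + 1)) := by
    rintro v j w ⟨hadj, hcol⟩
    rw [SimpleGraph.boxProd_adj] at hadj
    rcases hadj with ⟨-, hj⟩ | ⟨hj, hv⟩
    · exact absurd hj (Fin.castSucc_lt_last j).ne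
    · obtain rfl : v = w := hv
      have hjl : j = Fin.last n := by
        rw [SimpleGraph.pathGraph_adj] at hj
        have := j.isLt
        simp only [Fin.val_castSucc, Fin.val_last] at hj
        exact Fin.ext (by simp only [Fin.val_last]; omega)
      subst hjl
      have hcv : c v = c' v := hcol
      rw [F_castSucc, F_last]
      rcases top_spec (c' v) with ⟨u, -, hu, htop⟩ | ⟨hnew, -⟩
      · rw [htop]
        exact congrArg Sum.inl (SimpleGraph.ConnectedComponent.sound
          (reachable_of_same_layer g _ (hcv.trans hu.symm)))
      · exact absurd hcv (hnew v rfl)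
  have adj_F : ∀ p q, H'.Adj p q → F p = F q := by
    rintro ⟨v, i⟩ ⟨w, j⟩ hadj
    induction i using Fin.lastCases with
    | last =>
      induction j using Fin.lastCases with
      | last =>
        rw [F_last, F_last]
        exact congrArg top hadj.2
      | cast j => exact (cross _ _ _ hadj.symm).symm
    | cast i =>
      induction j using Fin.lastCases with
      | last => exact cross _ _ _ hadj
      | cast j =>
        rw [F_castSucc, F_castSucc]
        refine congrArg Sum.inl (SimpleGraph.ConnectedComponent.sound
          (SimpleGraph.Adj.reachable ⟨?_, hadj.2⟩))
        have := hadj.1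
        rw [SimpleGraph.boxProd_adj] at this ⊢
        simpa [SimpleGraph.pathGraph_adj] using this
  have lift_reach : ∀ p q : Fin 3 × Fin (n + 1), H.Reachable p q →
      H'.Reachable (p.1, p.2.castSucc) (q.1, q.2.castSucc) := fun p q hpq => by
    let f : H →g H' :=
      { toFun := fun p => (p.1, p.2.castSucc)
        map_rel' := fun {a b} hab => ⟨by
          have := hab.1
          rw [SimpleGraph.boxProd_adj] at this ⊢
          simpa [SimpleGraph.pathGraph_adj] using this, hab.2⟩ }
    exact hpq.map f
  have cross_reach : ∀ v j w, F (v, Fin.castSucc j) = F (w, Fin.last (n + 1)) →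
      H'.Reachable (v, Fin.castSucc j) (w, Fin.last (n + 1)) := by
    intro v j w hF
    rw [F_castSucc, F_last] at hF
    rcases top_spec (c' w) with ⟨u, hu', hu, htop⟩ | ⟨-, htop⟩
    · rw [htop] at hF
      refine (lift_reach _ _ (SimpleGraph.ConnectedComponent.exact (Sum.inl.inj hF))).trans ?_
      refine SimpleGraph.Reachable.trans (SimpleGraph.Adj.reachable ?_)
        (reachable_of_same_layer h _ hu')
      refine ⟨SimpleGraph.boxProd_adj.2 (Or.inr ⟨?_, rfl⟩), hu.trans hu'.symm⟩
      simp [SimpleGraph.pathGraph_adj]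
    · rw [htop] at hF
      exact absurd hF (by simp)
  -- An old component has one color, so it can be continued by that color only.
  have top_inj : Function.Injective top := by
    intro a b hab
    rcases top_spec a with ⟨u, -, hu, ha⟩ | ⟨-, ha⟩ <;>
      rcases top_spec b with ⟨u', -, hu', hb⟩ | ⟨-, hb⟩ <;> rw [ha, hb] at hab
    · rw [← hu, ← hu']
      exact monoGraph_reachable_color (c := stackColor g)
        (SimpleGraph.ConnectedComponent.exact (Sum.inl.inj hab))
    · exact absurd hab (by simp)
    · exact absurd hab (by simp)
    · exact Sum.inr.inj hab
  have reach_iff : ∀ p q, H'.Reachable p q ↔ F p = F q := by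
    intro p q
    constructor
    · rintro ⟨w⟩
      induction w with
      | nil => rfl
      | cons hadj _ ih => exact (adj_F _ _ hadj).trans ih
    · obtain ⟨v, i⟩ := p
      obtain ⟨w, j⟩ := q
      intro hF
      induction i using Fin.lastCases with
      | last =>
        induction j using Fin.lastCases with
        | last =>
          rw [F_last, F_last] at hF
          exact reachable_of_same_layer h _ (top_inj hF)
        | cast j => exact (cross_reach _ _ _ hF.symm).symm
      | cast i =>
        induction j using Fin.lastCases with
        | last => exact cross_reach _ _ _ hF
        | cast j =>
          rw [F_castSucc, F_castSucc] at hF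
          exact lift_reach _ _ (SimpleGraph.ConnectedComponent.exact (Sum.inl.inj hF))
  -- Every old component is attained on the lower layers; the new triangle adds precisely the labels
  -- of its new colors.
  have hrange : Set.range F = Sum.inl '' Set.univ ∪ Sum.inr ''
      (((Finset.univ.image c').filter fun a => ∀ v, c' v = a → c v ≠ a : Finset K) : Set K) := by
    ext z
    constructor
    · rintro ⟨⟨v, i⟩, rfl⟩
      induction i using Fin.lastCases with
      | last =>
        rw [F_last]
        rcases top_spec (c' v) with ⟨u, -, -, ha⟩ | ⟨hn, ha⟩
        · exact Or.inl ⟨_, trivial, ha.symm⟩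
        · exact Or.inr ⟨c' v, by simpa using hn, ha.symm⟩
      | cast i => exact Or.inl ⟨_, trivial, (F_castSucc v i).symm⟩
    · rintro (⟨C, -, rfl⟩ | ⟨a, ha, rfl⟩)
      · induction C using SimpleGraph.ConnectedComponent.ind with
        | h p => exact ⟨(p.1, p.2.castSucc), F_castSucc p.1 p.2⟩
      · simp only [Finset.coe_filter, Finset.mem_image, Finset.mem_univ, true_and,
          Set.mem_ofPred_eq] at ha
        obtain ⟨⟨v, hv⟩, hn⟩ := ha
        refine ⟨(v, Fin.last (n + 1)), ?_⟩
        rw [F_last, hv]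
        rcases top_spec a with ⟨u, hu', hu, -⟩ | ⟨-, ha⟩
        · exact absurd hu (hn u hu')
        · exact ha
  rw [monoCount, card_connectedComponent_eq_ncard_range F reach_iff, hrange,
    Set.ncard_union_eq, Set.ncard_image_of_injective _ Sum.inl_injective,
    Set.ncard_image_of_injective _ Sum.inr_injective, Set.ncard_univ, Set.ncard_coe_finset]
  · rfl
  · rw [Set.disjoint_left]
    rintro _ ⟨C, -, rfl⟩ ⟨a, -, ha⟩
    exact absurd ha (by simp)

theorem monoCount_one {K : Type*} [DecidableEq K] (h : Fin 1 → Fin 3 → K) :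
    monoCount (U 1) (stackColor h) = (Finset.univ.image (h 0)).card := by
  rw [monoCount, card_connectedComponent_eq_ncard_range (stackColor h), ← Set.ncard_coe_finset]
  · congr 1
    ext a
    constructor
    · rintro ⟨⟨v, i⟩, rfl⟩
      rw [Subsingleton.elim i 0]
      simp [stackColor]
    · intro ha
      obtain ⟨v, -, rfl⟩ := Finset.mem_image.1 (Finset.mem_coe.1 ha)
      exact ⟨(v, 0), rfl⟩
  · rintro ⟨v, i⟩ ⟨w, j⟩
    obtain rfl := Subsingleton.elim i j
    exact ⟨monoGraph_reachable_color, fun hc => reachable_of_same_layer h i hc⟩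

/-! ### Weighted counts of the triangle colorings that can follow a given one -/

/-- Weight `1` on `S` and weight `y` off `S`. -/
def offWeight {K R : Type*} [DecidableEq K] [CommRing R] (y : R) (S : Finset K) (a : K) : R :=
  if a ∈ S then 1 else y

section offWeight

variable {K R : Type*} [DecidableEq K] [CommRing R] (y : R)

theorem offWeight_eq (S : Finset K) (a : K) :
    offWeight y S a = y + (1 - y) * if a ∈ S then 1 else 0 := by
  unfold offWeight; split_ifs <;> ring

variable [Fintype K]

theorem sum_ite_mem_one (S : Finset K) :
    ∑ a, (if a ∈ S then (1 : R) else 0) = S.card := by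
  simp

theorem sum_offWeight (S : Finset K) :
    ∑ a, offWeight y S a = Fintype.card K * y + (1 - y) * S.card := by
  simp only [offWeight_eq, Finset.sum_add_distrib, ← Finset.mul_sum]
  simp

theorem sum_offWeight_mul (S S' : Finset K) :
    ∑ a, offWeight y S a * offWeight y S' a = Fintype.card K * y ^ 2 +
      y * (1 - y) * (S.card + S'.card) + (1 - y) ^ 2 * (S ∩ S').card := by
  have h : ∀ a, offWeight y S a * offWeight y S' a = y ^ 2 +
      y * (1 - y) * ((if a ∈ S then 1 else 0) + (if a ∈ S' then 1 else 0)) +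
      (1 - y) ^ 2 * (if a ∈ S ∩ S' then 1 else 0) := fun a => by
    simp only [offWeight, Finset.mem_inter]
    by_cases h1 : a ∈ S <;> by_cases h2 : a ∈ S' <;> simp [h1, h2] <;> ring
  simp only [h, Finset.sum_add_distrib, ← Finset.mul_sum, sum_ite_mem_one]
  simp

/-- Each weight is y + (1 - y) times the indicator of its set; expand the product and use that
indicators multiply to the indicator of the intersection. -/
theorem sum_offWeight_mul_mul (S S' S'' : Finset K) :
    ∑ a, offWeight y S a * offWeight y S' a * offWeight y S'' a = Fintype.card K * y ^ 3 +
      y ^ 2 * (1 - y) * (S.card + S'.card + S''.card) +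
      y * (1 - y) ^ 2 * ((S ∩ S').card + (S ∩ S'').card + (S' ∩ S'').card) +
      (1 - y) ^ 3 * (S ∩ S' ∩ S'').card := by
  have h : ∀ a, offWeight y S a * offWeight y S' a * offWeight y S'' a = y ^ 3 +
      y ^ 2 * (1 - y) * ((if a ∈ S then 1 else 0) + (if a ∈ S' then 1 else 0) +
        (if a ∈ S'' then 1 else 0)) +
      y * (1 - y) ^ 2 * ((if a ∈ S ∩ S' then 1 else 0) + (if a ∈ S ∩ S'' then 1 else 0) +
        (if a ∈ S' ∩ S'' then 1 else 0)) +
      (1 - y) ^ 3 * (if a ∈ S ∩ S' ∩ S'' then 1 else 0) := fun a => by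
    simp only [offWeight, Finset.mem_inter]
    by_cases h1 : a ∈ S <;> by_cases h2 : a ∈ S' <;> by_cases h3 : a ∈ S'' <;>
      simp [h1, h2, h3] <;> ring
  simp only [h, Finset.sum_add_distrib, ← Finset.mul_sum, sum_ite_mem_one]
  simp

end offWeight

theorem image_univ_fin_three {K : Type*} [DecidableEq K] (c : Fin 3 → K) :
    Finset.univ.image c = {c 0, c 1, c 2} := by
  ext a; simp [Fin.exists_fin_succ, eq_comm]

theorem card_image_fin_three_mem {K : Type*} [DecidableEq K] (c : Fin 3 → K) :
    (Finset.univ.image c).card = 1 ∨ (Finset.univ.image c).card = 2 ∨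
      (Finset.univ.image c).card = 3 := by
  have h1 : 0 < (Finset.univ.image c).card := Finset.card_pos.2 ⟨c 0, by simp⟩
  have h2 : (Finset.univ.image c).card ≤ 3 := Finset.card_image_le
  omega

theorem sum_fin_three_fun {K R : Type*} [Fintype K] [AddCommMonoid R]
    (f : K → K → K → R) :
    ∑ c : Fin 3 → K, f (c 0) (c 1) (c 2) = ∑ a, ∑ b, ∑ d, f a b d := by
  let e : (Fin 3 → K) ≃ (K × K) × K :=
    { toFun := fun c => ((c 0, c 1), c 2)
      invFun := fun p => ![p.1.1, p.1.2, p.2]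
      left_inv := fun c => by
        funext i
        fin_cases i <;> rfl
      right_inv := fun p => rfl }
  have h := Fintype.sum_equiv e (fun c => f (c 0) (c 1) (c 2)) (fun p => f p.1.1 p.1.2 p.2)
    fun c => rfl
  rw [h]
  simp only [Fintype.sum_prod_type]

section collapse

variable {K R : Type*} [Fintype K] [DecidableEq K] [AddCommMonoid R]

theorem sum_ite_fst_eq_snd (f : K → K → R) :
    ∑ a, ∑ b, ∑ d, (if a = b then f a d else 0) = ∑ a, ∑ d, f a d := by
  refine Finset.sum_congr rfl fun a _ => ?_
  rw [Finset.sum_comm]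
  simp

theorem sum_ite_fst_eq_thd (f : K → K → R) :
    ∑ a, ∑ b, ∑ d, (if a = d then f a b else 0) = ∑ a, ∑ b, f a b := by
  simp

theorem sum_ite_snd_eq_thd (f : K → K → R) :
    ∑ a, ∑ b, ∑ d, (if b = d then f a b else 0) = ∑ a, ∑ b, f a b := by
  simp

theorem sum_ite_all_eq (f : K → R) :
    ∑ a, ∑ b, ∑ d, (if a = b then if a = d then f a else 0 else 0) = ∑ a, f a := by
  rw [sum_ite_fst_eq_snd fun a d => if a = d then f a else (0 : R)]
  simp

end collapse

theorem pow_newColors {K R : Type*} [DecidableEq K] [CommRing R] (y : R) (c c' : Fin 3 → K) :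
    y ^ newColors c c' =
      ∏ a ∈ {c' 0, c' 1, c' 2}, if ∀ v, c' v = a → c v ≠ a then y else 1 := by
  rw [newColors, image_univ_fin_three, Finset.prod_ite]
  simp

section counts

variable {K R : Type*} [Fintype K] [DecidableEq K] [CommRing R] (y : R)

theorem sum_newColors_one (c : Fin 3 → K) :
    ∑ c' with (Finset.univ.image c').card = 1, y ^ newColors c c' =
      ∑ a, offWeight y {c 0, c 1, c 2} a := by
  rw [Finset.sum_filter]
  have h : ∀ c' : Fin 3 → K,
      (if (Finset.univ.image c').card = 1 then y ^ newColors c c' else 0) =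
      if c' 0 = c' 1 then if c' 0 = c' 2 then offWeight y {c 0, c 1, c 2} (c' 0)
        else 0 else 0 := fun c' => by
    rw [pow_newColors, image_univ_fin_three]
    by_cases h1 : c' 0 = c' 1 <;> by_cases h2 : c' 0 = c' 2 <;> by_cases h3 : c' 1 = c' 2 <;>
      simp_all [Fin.forall_fin_succ, offWeight, Finset.card_insert_of_notMem]
    grind
  simp only [h]
  rw [sum_fin_three_fun fun a b d =>
    if a = b then if a = d then offWeight y {c 0, c 1, c 2} a else 0 else 0, sum_ite_all_eq]

/-- A color used by `c'` on a set of vertices has weight 1 exactly when it is among the colors of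
`c` on that set. For each of the three ways to pair two vertices, sum over all pairs of colors and
subtract the diagonal. -/
theorem sum_newColors_two (c : Fin 3 → K) :
    ∑ c' with (Finset.univ.image c').card = 2, y ^ newColors c c' =
      (∑ a, offWeight y {c 0, c 1} a) * (∑ a, offWeight y {c 2} a) +
      (∑ a, offWeight y {c 0, c 2} a) * (∑ a, offWeight y {c 1} a) +
      (∑ a, offWeight y {c 1, c 2} a) * (∑ a, offWeight y {c 0} a) -
      ((∑ a, offWeight y {c 0, c 1} a * offWeight y {c 2} a) +
        (∑ a, offWeight y {c 0, c 2} a * offWeight y {c 1} a) +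
        (∑ a, offWeight y {c 1, c 2} a * offWeight y {c 0} a)) := by
  rw [Finset.sum_filter]
  -- A constant `c'` satisfies all three pair conditions; the last term cancels these contributions.
  have h : ∀ c' : Fin 3 → K,
      (if (Finset.univ.image c').card = 2 then y ^ newColors c c' else 0) =
      (if c' 0 = c' 1 then offWeight y {c 0, c 1} (c' 0) * offWeight y {c 2} (c' 2) else 0) +
      (if c' 0 = c' 2 then offWeight y {c 0, c 2} (c' 0) * offWeight y {c 1} (c' 1) else 0) +
      (if c' 1 = c' 2 then offWeight y {c 1, c 2} (c' 1) * offWeight y {c 0} (c' 0) else 0) -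
      (if c' 0 = c' 1 then if c' 0 = c' 2 then
        offWeight y {c 0, c 1} (c' 0) * offWeight y {c 2} (c' 0) +
        offWeight y {c 0, c 2} (c' 0) * offWeight y {c 1} (c' 0) +
        offWeight y {c 1, c 2} (c' 0) * offWeight y {c 0} (c' 0) else 0 else 0) := fun c' => by
    rw [pow_newColors, image_univ_fin_three]
    by_cases h1 : c' 0 = c' 1 <;> by_cases h2 : c' 0 = c' 2 <;> by_cases h3 : c' 1 = c' 2 <;>
      simp_all [Fin.forall_fin_succ, offWeight, Finset.card_insert_of_notMem] <;> grind
  simp only [h, Finset.sum_sub_distrib, Finset.sum_add_distrib]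
  rw [sum_fin_three_fun fun a b d =>
      if a = b then offWeight y {c 0, c 1} a * offWeight y {c 2} d else 0,
    sum_fin_three_fun fun a b d =>
      if a = d then offWeight y {c 0, c 2} a * offWeight y {c 1} b else 0,
    sum_fin_three_fun fun a b d =>
      if b = d then offWeight y {c 1, c 2} b * offWeight y {c 0} a else 0,
    sum_fin_three_fun fun a b d => if a = b then if a = d then
        offWeight y {c 0, c 1} a * offWeight y {c 2} a +
        offWeight y {c 0, c 2} a * offWeight y {c 1} a +
        offWeight y {c 1, c 2} a * offWeight y {c 0} a else 0 else 0,
    sum_ite_fst_eq_snd fun a d => offWeight y {c 0, c 1} a * offWeight y {c 2} d,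
    sum_ite_fst_eq_thd fun a b => offWeight y {c 0, c 2} a * offWeight y {c 1} b,
    sum_ite_snd_eq_thd fun a b => offWeight y {c 1, c 2} b * offWeight y {c 0} a,
    sum_ite_all_eq]
  simp only [Finset.sum_add_distrib, ← Finset.mul_sum, ← Finset.sum_mul]

/-- Inclusion-exclusion over coincidences. The factor 2 is the Möbius coefficient: constant triples
are counted once, removed three times, and restored twice. -/
theorem sum_newColors_three (c : Fin 3 → K) :
    ∑ c' with (Finset.univ.image c').card = 3, y ^ newColors c c' =
      (∑ a, offWeight y {c 0} a) * (∑ a, offWeight y {c 1} a) * (∑ a, offWeight y {c 2} a) -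
      (∑ a, offWeight y {c 0} a * offWeight y {c 1} a) * (∑ a, offWeight y {c 2} a) -
      (∑ a, offWeight y {c 0} a * offWeight y {c 2} a) * (∑ a, offWeight y {c 1} a) -
      (∑ a, offWeight y {c 1} a * offWeight y {c 2} a) * (∑ a, offWeight y {c 0} a) +
      2 * ∑ a, offWeight y {c 0} a * offWeight y {c 1} a * offWeight y {c 2} a := by
  rw [Finset.sum_filter]
  have h : ∀ c' : Fin 3 → K,
      (if (Finset.univ.image c').card = 3 then y ^ newColors c c' else 0) =
      offWeight y {c 0} (c' 0) * offWeight y {c 1} (c' 1) * offWeight y {c 2} (c' 2) -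
      (if c' 0 = c' 1 then
        offWeight y {c 0} (c' 0) * offWeight y {c 1} (c' 0) * offWeight y {c 2} (c' 2) else 0) -
      (if c' 0 = c' 2 then
        offWeight y {c 0} (c' 0) * offWeight y {c 2} (c' 0) * offWeight y {c 1} (c' 1) else 0) -
      (if c' 1 = c' 2 then
        offWeight y {c 1} (c' 1) * offWeight y {c 2} (c' 1) * offWeight y {c 0} (c' 0) else 0) +
      (if c' 0 = c' 1 then if c' 0 = c' 2 then 2 *
        (offWeight y {c 0} (c' 0) * offWeight y {c 1} (c' 0) * offWeight y {c 2} (c' 0))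
        else 0 else 0) := fun c' => by
    by_cases h1 : c' 0 = c' 1
    · have hcard : (Finset.univ.image c').card ≠ 3 := by
        rw [image_univ_fin_three, h1]
        have := Finset.card_le_two (a := c' 1) (b := c' 2)
        simp only [Finset.insert_eq_of_mem, Finset.mem_insert_self]
        omega
      rw [if_neg hcard]
      by_cases h2 : c' 1 = c' 2
      · simp only [h1, h2, if_true]
        ring
      · simp only [h1, h2, if_true, if_false]
        ring
    · by_cases h2 : c' 0 = c' 2
      · have hcard : (Finset.univ.image c').card ≠ 3 := by
          rw [image_univ_fin_three, h2]
          have := Finset.card_le_two (a := c' 1) (b := c' 2)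
          rw [Finset.insert_eq_of_mem (by simp)]
          omega
        have h3 : ¬ c' 1 = c' 2 := fun h => h1 (h2.trans h.symm)
        rw [if_neg hcard, if_neg h1, if_pos h2, if_neg h3, if_neg h1, h2]
        ring
      · rw [if_neg h1, if_neg h2, if_neg h1]
        by_cases h3 : c' 1 = c' 2
        · have hcard : (Finset.univ.image c').card ≠ 3 := by
            rw [image_univ_fin_three, h3]
            have := Finset.card_le_two (a := c' 0) (b := c' 2)
            simp only [Finset.pair_eq_singleton]
            omega
          rw [if_neg hcard, if_pos h3, h3]
          ring
        -- With three distinct colors each one sits on a single vertex, so whether it is new is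
        -- decided there.
        · have e0 : (∀ v, c' v = c' 0 → c v ≠ c' 0) ↔ c' 0 ≠ c 0 := by
            simp [Fin.forall_fin_succ, Ne.symm h1, Ne.symm h2, eq_comm]
          have e1 : (∀ v, c' v = c' 1 → c v ≠ c' 1) ↔ c' 1 ≠ c 1 := by
            simp [Fin.forall_fin_succ, h1, Ne.symm h3, eq_comm]
          have e2 : (∀ v, c' v = c' 2 → c v ≠ c' 2) ↔ c' 2 ≠ c 2 := by
            simp [Fin.forall_fin_succ, h2, h3, eq_comm]
          have hcard : (Finset.univ.image c').card = 3 := by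
            rw [image_univ_fin_three]
            exact Finset.card_eq_three.2 ⟨_, _, _, h1, h2, h3, rfl⟩
          rw [if_pos hcard, if_neg h3, pow_newColors, Finset.prod_insert (by simp [h1, h2]),
            Finset.prod_insert (by simp [h3]), Finset.prod_singleton]
          simp only [e0, e1, e2, offWeight, Finset.mem_singleton, ite_not]
          ring
  simp only [h, Finset.sum_sub_distrib, Finset.sum_add_distrib]
  rw [sum_fin_three_fun fun a b d =>
      offWeight y {c 0} a * offWeight y {c 1} b * offWeight y {c 2} d,
    sum_fin_three_fun fun a b d => if a = b then
      offWeight y {c 0} a * offWeight y {c 1} a * offWeight y {c 2} d else 0,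
    sum_fin_three_fun fun a b d => if a = d then
      offWeight y {c 0} a * offWeight y {c 2} a * offWeight y {c 1} b else 0,
    sum_fin_three_fun fun a b d => if b = d then
      offWeight y {c 1} b * offWeight y {c 2} b * offWeight y {c 0} a else 0,
    sum_fin_three_fun fun a b d => if a = b then if a = d then
        2 * (offWeight y {c 0} a * offWeight y {c 1} a * offWeight y {c 2} a) else 0 else 0,
    sum_ite_fst_eq_snd fun a d => offWeight y {c 0} a * offWeight y {c 1} a * offWeight y {c 2} d,
    sum_ite_fst_eq_thd fun a b => offWeight y {c 0} a * offWeight y {c 2} a * offWeight y {c 1} b,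
    sum_ite_snd_eq_thd fun a b => offWeight y {c 1} b * offWeight y {c 2} b * offWeight y {c 0} a,
    sum_ite_all_eq]
  simp only [← Finset.mul_sum, ← Finset.sum_mul]

end counts

/-! ### Transfer and initial coefficients -/

/-- The transfer coefficient: the weighted number of triangle colorings with `i` colors that can
follow a triangle coloring with `j` colors. -/
def transferCoeff {R : Type*} [CommRing R] (k y : R) : ℕ → ℕ → R
  | 1, 1 => 1 + (k - 1) * y
  | 1, 2 => 2 + (k - 2) * y
  | 1, 3 => 3 + (k - 3) * y
  | 2, 1 => 6 * (k - 1) * y + 3 * (k - 1) * (k - 2) * y ^ 2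
  | 2, 2 => 3 + 2 * y + y ^ 2 + 8 * (k - 2) * y + 4 * (k - 2) * y ^ 2 +
      3 * (k - 2) * (k - 3) * y ^ 2
  | 2, 3 => 6 + 6 * y + 6 * y ^ 2 + 9 * (k - 3) * y + 9 * (k - 3) * y ^ 2 +
      3 * (k - 3) * (k - 4) * y ^ 2
  | 3, 1 => 3 * (k - 1) * (k - 2) * y ^ 2 + (k - 1) * (k - 2) * (k - 3) * y ^ 3
  | 3, 2 => 2 * (k - 2) * y + 2 * (k - 2) * y ^ 2 + 2 * (k - 2) * y ^ 3 +
      3 * (k - 2) * (k - 3) * y ^ 2 + 3 * (k - 2) * (k - 3) * y ^ 3 +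
      (k - 2) * (k - 3) * (k - 4) * y ^ 3
  | 3, 3 => 1 + 3 * y ^ 2 + 2 * y ^ 3 +
      3 * (k - 3) * y + 6 * (k - 3) * y ^ 2 + 9 * (k - 3) * y ^ 3 +
      3 * (k - 3) * (k - 4) * y ^ 2 + 6 * (k - 3) * (k - 4) * y ^ 3 +
      (k - 3) * (k - 4) * (k - 5) * y ^ 3
  | _, _ => 0

/-- The initial coefficient: the weighted number of triangle colorings with `i` colors. -/
def initCoeff {R : Type*} [CommRing R] (k y : R) : ℕ → R
  | 1 => k * y
  | 2 => 3 * k * (k - 1) * y ^ 2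
  | 3 => k * (k - 1) * (k - 2) * y ^ 3
  | _ => 0

section counts

variable {K R : Type*} [Fintype K] [DecidableEq K] [CommRing R] (y : R)

/-- The sums above involve only the cardinalities of sets of values of `c` and of their
intersections, which are fixed by the equalities among `c 0`, `c 1`, `c 2`. Checking each equality
pattern shows that only the number of colors matters. -/
theorem sum_pow_newColors (c : Fin 3 → K) {i : ℕ} (hi : i = 1 ∨ i = 2 ∨ i = 3) :
    ∑ c' with (Finset.univ.image c').card = i, y ^ newColors c c' =
      transferCoeff (Fintype.card K : R) y i (Finset.univ.image c).card := by
  rcases hi with rfl | rfl | rfl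
  · rw [sum_newColors_one, sum_offWeight, image_univ_fin_three]
    by_cases h1 : c 0 = c 1 <;> by_cases h2 : c 0 = c 2 <;> by_cases h3 : c 1 = c 2 <;>
      simp_all [transferCoeff, Finset.card_insert_of_notMem] <;> ring
  · rw [sum_newColors_two, image_univ_fin_three]
    simp only [sum_offWeight, sum_offWeight_mul]
    by_cases h1 : c 0 = c 1 <;> by_cases h2 : c 0 = c 2 <;> by_cases h3 : c 1 = c 2 <;>
      simp_all [transferCoeff, Finset.card_insert_of_notMem, Finset.inter_singleton_of_notMem] <;>
      ring
  · rw [sum_newColors_three, image_univ_fin_three]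
    simp only [sum_offWeight, sum_offWeight_mul, sum_offWeight_mul_mul]
    by_cases h1 : c 0 = c 1 <;> by_cases h2 : c 0 = c 2 <;> by_cases h3 : c 1 = c 2 <;>
      simp_all [transferCoeff, Finset.card_insert_of_notMem, Finset.inter_singleton_of_notMem] <;>
      ring

/-- All terms equal y ^ i, so only the number of triangle colorings with i colors is needed;
`sum_pow_newColors` at y = 1, with a constant coloring as predecessor, supplies it. -/
theorem sum_pow_card_image [Nonempty K] {i : ℕ} (hi : i = 1 ∨ i = 2 ∨ i = 3) :
    ∑ c : Fin 3 → K with (Finset.univ.image c).card = i, y ^ (Finset.univ.image c).card =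
      initCoeff (Fintype.card K : R) y i := by
  have h := sum_pow_newColors (1 : R) (fun _ => Classical.arbitrary K : Fin 3 → K) hi
  have hc : (Finset.univ.image (fun _ => Classical.arbitrary K : Fin 3 → K)).card = 1 := by
    rw [image_univ_fin_three]; simp
  simp only [one_pow, hc] at h
  rw [Finset.sum_congr rfl fun c hc => by rw [(Finset.mem_filter.1 hc).2], ← mul_one (y ^ i),
    ← Finset.mul_sum, h]
  rcases hi with rfl | rfl | rfl <;> simp only [transferCoeff, initCoeff] <;> ring

end counts

/-! ### Generating functions by layers -/

theorem isEmpty_coloredPartition_zero (k : ℕ) : IsEmpty (ColoredPartition (U 0) k) :=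
  ⟨fun T => by
    obtain ⟨B, hB⟩ := T.nonempty
    obtain ⟨v, -⟩ := T.partition.nonempty_of_mem_parts hB
    exact v.2.elim0⟩

/-- Sequences of triangle colorings are the same as vertex colorings of `K₃ × Pₙ`. -/
def stackEquiv (K : Type*) (n : ℕ) : (Fin n → Fin 3 → K) ≃ (Fin 3 × Fin n → K) where
  toFun := stackColor
  invFun c j v := c (v, j)
  left_inv _ := rfl
  right_inv _ := rfl

/-- The colored partitions of `K₃ × Pₙ₊₁` as sequences of triangle colorings. -/
noncomputable def layerEquiv (k n : ℕ) :
    ColoredPartition (U (n + 1)) k ≃ (Fin (n + 1) → Fin 3 → Fin k) :=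
  ColoredPartition.equivVertexColor.trans (stackEquiv (Fin k) (n + 1)).symm

theorem size_eq_layer {k n : ℕ} (T : ColoredPartition (U (n + 1)) k) :
    T.size = monoCount (U (n + 1)) (stackColor (layerEquiv k n T)) :=
  T.size_eq_monoCount

theorem lastColors_eq_layer {k n : ℕ} (T : ColoredPartition (U (n + 1)) k) :
    lastColors T = (Finset.univ.image (layerEquiv k n T (Fin.last n))).card := by
  rw [lastColors_eq, ← Set.ncard_coe_finset, Finset.coe_image, Finset.coe_univ, Set.image_univ]
  rfl

/-- The size enumerator of the colored partitions of `K₃ × Pₙ₊₁` with `i` colors in the last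
triangle, in terms of sequences of triangle colorings. -/
noncomputable def layerSum (k i n : ℕ) : ℤ[X] :=
  ∑ h : Fin (n + 1) → Fin 3 → Fin k with (Finset.univ.image (h (Fin.last n))).card = i,
    (X : ℤ[X]) ^ monoCount (U (n + 1)) (stackColor h)

theorem coeff_zero_genFunLast (k i : ℕ) : PowerSeries.coeff 0 (genFunLast k i) = 0 := by
  simp [genFunLast]

theorem coeff_succ_genFunLast (k i n : ℕ) :
    PowerSeries.coeff (n + 1) (genFunLast k i) = layerSum k i n := by
  classical
  rw [genFunLast, PowerSeries.coeff_mk, if_pos (Nat.le_add_left 1 n), layerSum,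
    Finset.sum_filter, Finset.sum_filter]
  exact Fintype.sum_equiv (layerEquiv k n) _ _ fun T => by
    rw [lastColors_eq_layer, size_eq_layer]

theorem genFun_eq_sum (k : ℕ) : genFun k = genFunLast k 1 + genFunLast k 2 + genFunLast k 3 := by
  classical
  ext1 n
  cases n with
  | zero =>
    have := isEmpty_coloredPartition_zero k
    rw [map_add, map_add, coeff_zero_genFunLast, coeff_zero_genFunLast, coeff_zero_genFunLast]
    simp [genFun]
  | succ n =>
    rw [map_add, map_add, genFun, genFunLast, genFunLast, genFunLast]
    simp only [PowerSeries.coeff_mk, if_pos (Nat.le_add_left 1 n), Finset.sum_filter]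
    rw [← Finset.sum_add_distrib, ← Finset.sum_add_distrib]
    refine Finset.sum_congr rfl fun T _ => ?_
    rw [lastColors_eq_layer]
    rcases card_image_fin_three_mem (layerEquiv k n T (Fin.last n)) with h | h | h <;> simp [h]

theorem layerSum_zero {k i : ℕ} (hk : 1 ≤ k) (hi : i = 1 ∨ i = 2 ∨ i = 3) :
    layerSum k i 0 = initCoeff (k : ℤ[X]) X i := by
  have : Nonempty (Fin k) := ⟨⟨0, hk⟩⟩
  have h := sum_pow_card_image (K := Fin k) (X : ℤ[X]) hi
  rw [Fintype.card_fin] at h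
  rw [← h, layerSum, Finset.sum_filter, Finset.sum_filter]
  refine Fintype.sum_equiv (Equiv.funUnique (Fin 1) (Fin 3 → Fin k)) _ _ fun c => ?_
  rw [monoCount_one]
  rfl

/-- Removing the last triangle factors the weight into the old weight and y ^ `newColors`; the sum
over the last triangle is then a transfer coefficient, constant on each class of the preceding
triangle. -/
theorem layerSum_succ {k i : ℕ} (n : ℕ) (hi : i = 1 ∨ i = 2 ∨ i = 3) :
    layerSum k i (n + 1) = transferCoeff (k : ℤ[X]) X i 1 * layerSum k 1 n +
      transferCoeff (k : ℤ[X]) X i 2 * layerSum k 2 n +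
      transferCoeff (k : ℤ[X]) X i 3 * layerSum k 3 n := by
  have step : layerSum k i (n + 1) = ∑ h : Fin (n + 1) → Fin 3 → Fin k,
      (X : ℤ[X]) ^ monoCount (U (n + 1)) (stackColor h) *
        transferCoeff (k : ℤ[X]) X i (Finset.univ.image (h (Fin.last n))).card := by
    -- `Fin.snocEquiv` splits a sequence of triangles into its last triangle and the rest.
    rw [layerSum, Finset.sum_filter,
      ← (Fin.snocEquiv fun _ : Fin (n + 2) => Fin 3 → Fin k).sum_comp, Fintype.sum_prod_type_right]
    refine Finset.sum_congr rfl fun h _ => ?_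
    have hs := sum_pow_newColors (X : ℤ[X]) (h (Fin.last n)) hi
    rw [Fintype.card_fin] at hs
    rw [← hs, Finset.mul_sum, Finset.sum_filter]
    refine Finset.sum_congr rfl fun c _ => ?_
    rw [monoCount_succ]
    simp [Fin.snocEquiv, pow_add]
  rw [step]
  simp only [layerSum, Finset.sum_filter, Finset.mul_sum]
  rw [← Finset.sum_add_distrib, ← Finset.sum_add_distrib]
  refine Finset.sum_congr rfl fun h _ => ?_
  rcases card_image_fin_three_mem (h (Fin.last n)) with hc | hc | hc <;> simp [hc, mul_comm]

theorem genFunLast_eq {k i : ℕ} (hk : 1 ≤ k) (hi : i = 1 ∨ i = 2 ∨ i = 3) :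
    genFunLast k i = xVar * (PowerSeries.C (initCoeff (k : ℤ[X]) X i) +
      PowerSeries.C (transferCoeff (k : ℤ[X]) X i 1) * genFunLast k 1 +
      PowerSeries.C (transferCoeff (k : ℤ[X]) X i 2) * genFunLast k 2 +
      PowerSeries.C (transferCoeff (k : ℤ[X]) X i 3) * genFunLast k 3) := by
  ext1 n
  cases n with
  | zero => rw [coeff_zero_genFunLast, PowerSeries.coeff_zero_X_mul]
  | succ n =>
    rw [PowerSeries.coeff_succ_X_mul, coeff_succ_genFunLast]
    simp only [map_add, PowerSeries.coeff_C_mul]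
    cases n with
    -- For one triangle the series on the right contribute their vanishing constant terms, so only
    -- the initial coefficient remains.
    | zero => simp [coeff_zero_genFunLast, layerSum_zero hk hi]
    | succ n =>
      simp only [coeff_succ_genFunLast, layerSum_succ n hi, PowerSeries.coeff_C,
        Nat.succ_ne_zero, if_false, zero_add]

theorem transferSystem_genFunLast {k : ℕ} (hk : 1 ≤ k) :
    TransferSystem (k : PowerSeries ℤ[X]) xVar yVar
      (genFunLast k 1) (genFunLast k 2) (genFunLast k 3) := by
  have h1 := genFunLast_eq (i := 1) hk (by simp)
  have h2 := genFunLast_eq (i := 2) hk (by simp)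
  have h3 := genFunLast_eq (i := 3) hk (by simp)
  simp only [initCoeff, transferCoeff, map_add, map_sub, map_mul, map_pow, map_natCast,
    map_ofNat, map_one] at h1 h2 h3
  exact ⟨by linear_combination h1, by linear_combination h2, by linear_combination h3⟩

/-! ### Elimination and specialization -/

/-- Cramer's rule for the sum of the unknowns, without division: each equation is multiplied by the
sum of the cofactors of its row. -/
theorem cramer_three_sum {R : Type*} [CommRing R]
    {a b c d e f g h i u v w X Y Z : R} (h1 : a * X + b * Y + c * Z = u)
    (h2 : d * X + e * Y + f * Z = v) (h3 : g * X + h * Y + i * Z = w) :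
    (X + Y + Z) * (a * (e * i - f * h) - b * (d * i - f * g) + c * (d * h - e * g)) =
      u * ((e * i - f * h) - (d * i - f * g) + (d * h - e * g)) +
      v * ((a * i - c * g) - (b * i - c * h) - (a * h - b * g)) +
      w * ((a * e - b * d) - (a * f - c * d) + (b * f - c * e)) := by
  linear_combination ((e * i - f * h) - (d * i - f * g) + (d * h - e * g)) * h1 +
    ((a * i - c * g) - (b * i - c * h) - (a * h - b * g)) * h2 +
    ((a * e - b * d) - (a * f - c * d) + (b * f - c * e)) * h3

theorem TransferSystem.sum_mul_denom {R : Type*} [CommRing R] {k x y T₁ T₂ T₃ : R}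
    (h : TransferSystem k x y T₁ T₂ T₃) :
    (T₁ + T₂ + T₃) * denom k x y = numer k x y := by
  obtain ⟨h1, h2, h3⟩ := h
  let t := transferCoeff k y
  have key := cramer_three_sum (X := T₁) (Y := T₂) (Z := T₃)
    (a := 1 - x * t 1 1) (b := -(x * t 1 2)) (c := -(x * t 1 3))
    (d := -(x * t 2 1)) (e := 1 - x * t 2 2) (f := -(x * t 2 3))
    (g := -(x * t 3 1)) (h := -(x * t 3 2)) (i := 1 - x * t 3 3)
    (u := x * initCoeff k y 1) (v := x * initCoeff k y 2) (w := x * initCoeff k y 3)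
    (by simp only [t, transferCoeff, initCoeff]; linear_combination h1)
    (by simp only [t, transferCoeff, initCoeff]; linear_combination h2)
    (by simp only [t, transferCoeff, initCoeff]; linear_combination h3)
  simp only [t, transferCoeff, initCoeff] at key
  convert key using 1
  · congr 1
    unfold denom
    ring
  · unfold numer
    ring

/-- The denominator has constant term 1 in x. -/
theorem isUnit_denom (k : ℕ) : IsUnit (denom (k : PowerSeries ℤ[X]) xVar yVar) := by
  rw [PowerSeries.isUnit_iff_constantCoeff]
  simp [denom]

/-- At y = 1 every colored partition has weight 1, so the coefficient is the number of vertex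
colorings. -/
theorem coeff_genFun_at_one {k n : ℕ} (hn : 1 ≤ n) :
    PowerSeries.coeff n (PowerSeries.map (Polynomial.evalRingHom (1 : ℤ)) (genFun k)) =
      (k : ℤ) ^ (3 * n) := by
  have : Nonempty (Fin 3 × Fin n) := ⟨(0, ⟨0, hn⟩)⟩
  rw [PowerSeries.coeff_map, genFun, PowerSeries.coeff_mk]
  simp [Fintype.card_congr (ColoredPartition.equivVertexColor (G := U n) (k := k))]

end ColoredPartitions

theorem mainTheorem9 (k : ℕ) (hk : 1 ≤ k) :
    -- `T(x,y) = p(x,y) / q(x,y)`, where `q` is invertible as a power series in `x`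
    (IsUnit (denom (k : PowerSeries ℤ[X]) xVar yVar) ∧
      genFun k * denom (k : PowerSeries ℤ[X]) xVar yVar
        = numer (k : PowerSeries ℤ[X]) xVar yVar) ∧
    -- the transfer system indexed by the number of colors in the last triangle
    (genFun k = genFunLast k 1 + genFunLast k 2 + genFunLast k 3 ∧
      TransferSystem (k : PowerSeries ℤ[X]) xVar yVar
        (genFunLast k 1) (genFunLast k 2) (genFunLast k 3)) ∧
    -- the coefficients of `T(x,1)`
    (∀ n : ℕ, 1 ≤ n →
      PowerSeries.coeff n (PowerSeries.map (Polynomial.evalRingHom (1 : ℤ)) (genFun k))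
        = (k : ℤ) ^ (3 * n)) := by
  have hT := transferSystem_genFunLast hk
  exact ⟨⟨isUnit_denom k, by rw [genFun_eq_sum]; exact hT.sum_mul_denom⟩,
    ⟨genFun_eq_sum k, hT⟩, fun _ hn => coeff_genFun_at_one hn⟩
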